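/- Let $l,n$ be positive integers, let $\mathcal V=\mathcal M_{l,1}^n$ be the space of $n$-tuples of column vectors in $\mathbb C^l$ (equivalently, of complex $l\times n$ matrices), and let $G=\mathrm{SL}_l(\mathbb C)$ act on $\mathcal V$ by simultaneous left multiplication. Let $\mathbb C[\mathcal V]^G$ be the algebra of $G$-invariant polynomial functions on $\mathcal V$, and let $$\mathcal S_{G,\mathcal V}=\{(v,w)\in\mathcal V^2 : f(v)=f(w)\ \text{for all } f\in\mathbb C[\mathcal V]^G\}$$ be the separating variety, a Zariski closed subset of $\mathcal V^2$. (a) Suppose $l\ge 3$ and $n\ge l+1$. Then $\mathcal S_{G,\mathcal V}$ has exactly two irreducible components, of dimensions $ln+l^2-1$ and $2(n+1)(l-1)$ respectively. Their intersection is a closed subvariety of dimension at most $ln+l^2-2$, with equality if $l=3$. (b) Suppose $l=2$. Then $\mathcal S_{G,\mathcal V}$ is irreducible. -/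

import Mathlib

noncomputable section

namespace SepVar

/-- Complex affine space with coordinates indexed by `σ`. This is a type synonym of `σ → ℂ`
which carries the Zariski topology (and not the Euclidean one). -/
def ZariskiSpace (σ : Type) : Type := σ → ℂ

/-- The Zariski topology: the closed sets are the zero loci of ideals of polynomials. -/
instance zariskiTopology (σ : Type) : TopologicalSpace (ZariskiSpace σ) :=
  TopologicalSpace.ofClosed
    {Z : Set (σ → ℂ) | ∃ I : Ideal (MvPolynomial σ ℂ), Z = MvPolynomial.zeroLocus ℂ I}
    ⟨⊤, MvPolynomial.zeroLocus_top.symm⟩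
    (by
      intro A hA
      refine ⟨sSup {I | MvPolynomial.zeroLocus ℂ I ∈ A}, ?_⟩
      refine Set.Subset.antisymm ?_ ?_
      · refine MvPolynomial.le_zeroLocus_iff_le_vanishingIdeal.2 (sSup_le fun I hI => ?_)
        exact MvPolynomial.le_zeroLocus_iff_le_vanishingIdeal.1 (Set.sInter_subset_of_mem hI)
      · intro x hx Z hZ
        obtain ⟨I, rfl⟩ := hA hZ
        exact MvPolynomial.zeroLocus_anti_mono (le_sSup hZ) hx)
    (by
      rintro _ ⟨I, rfl⟩ _ ⟨J, rfl⟩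
      refine ⟨I * J, Set.Subset.antisymm ?_ ?_⟩
      · rintro x (hx | hx)
        · exact MvPolynomial.zeroLocus_anti_mono Ideal.mul_le_left hx
        · exact MvPolynomial.zeroLocus_anti_mono Ideal.mul_le_right hx
      · intro x hx
        by_contra h
        obtain ⟨hI, hJ⟩ := not_or.1 h
        obtain ⟨p, hp⟩ := not_forall.1 hI
        obtain ⟨hp, hp0⟩ := Classical.not_imp.1 hp
        obtain ⟨q, hq⟩ := not_forall.1 hJ
        obtain ⟨hq, hq0⟩ := Classical.not_imp.1 hq
        have h0 := hx (p * q) (Ideal.mul_mem_mul hp hq)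
        rw [map_mul] at h0
        exact (mul_ne_zero hp0 hq0) h0)

/-- The dimension of a Zariski closed set `Z`: the Krull dimension of its coordinate ring
`ℂ[σ] / I(Z)`. -/
def zariskiDim {σ : Type} (Z : Set (ZariskiSpace σ)) : WithBot ℕ∞ :=
  ringKrullDim (MvPolynomial σ ℂ ⧸ MvPolynomial.vanishingIdeal ℂ (K := ℂ) (σ := σ) Z)

/-- The left multiplication action of `SL_l(ℂ)` on `l × n` matrices, that is, the diagonal action
on `n`-tuples of columns of length `l`. A matrix is recorded as the family of its entries. -/
def act {l n : ℕ} (g : Matrix.SpecialLinearGroup (Fin l) ℂ) (A : Fin l × Fin n → ℂ) :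
    Fin l × Fin n → ℂ :=
  fun p => ((g : Matrix (Fin l) (Fin l) ℂ) * Matrix.of fun i j => A (i, j)) p.1 p.2

/-- The algebra `ℂ[M_{l,1}^n]^{SL_l(ℂ)}` of invariant polynomials, where
`(g • f)(A) = f (g⁻¹ • A)`. -/
def invariants (l n : ℕ) : Subalgebra ℂ (MvPolynomial (Fin l × Fin n) ℂ) where
  carrier := {f | ∀ (g : Matrix.SpecialLinearGroup (Fin l) ℂ) (A : Fin l × Fin n → ℂ),
    MvPolynomial.eval (act g⁻¹ A) f = MvPolynomial.eval A f}
  mul_mem' := fun hf hh g A => by rw [map_mul, map_mul, hf g A, hh g A]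
  add_mem' := fun hf hh g A => by rw [map_add, map_add, hf g A, hh g A]
  algebraMap_mem' := fun r g A => by
    rw [MvPolynomial.algebraMap_eq, MvPolynomial.eval_C, MvPolynomial.eval_C]

/-- The separating variety: the pairs of points of `M_{l,1}^n` that no invariant separates.
A pair is a point of the affine space with two blocks of `l * n` coordinates. -/
def separatingVariety (l n : ℕ) : Set (ZariskiSpace ((Fin l × Fin n) ⊕ (Fin l × Fin n))) :=
  {p | ∀ f ∈ invariants l n,
    MvPolynomial.eval (fun c => p (Sum.inl c)) f = MvPolynomial.eval (fun c => p (Sum.inr c)) f}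

end SepVar

end

/-!
The invariant polynomials include the maximal minors, and two matrices of rank `l` with the same
minors lie in the same orbit, whereas all invariants are constant on matrices of rank `< l`. So the
separating variety is the union of the set `orbitPairs` of pairs in the same orbit and of the closed
set `degeneratePairs` of pairs of matrices of rank `< l`. Both `closure orbitPairs` and
`degeneratePairs` are closures of images of affine spaces under birational polynomial maps; this
proves irreducibility and gives the dimensions. If `l = 2`, every degenerate pair is a limit of
pairs in the same orbit. If `l ≥ 3` and `n > l`, then `degeneratePairs` has at least the dimension
of `closure orbitPairs`, so neither set contains the other. For `l = 3` the lower bound on the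
dimension of the intersection comes from an explicit family of degenerate limits.
-/

noncomputable section

namespace SepVar

open MvPolynomial

section KrullDimension

lemma ringKrullDim_le_of_isIntegral (R S : Type*) [CommRing R] [CommRing S] [Algebra R S]
    [Algebra.IsIntegral R S] : ringKrullDim S ≤ ringKrullDim R :=
  Order.krullDim_le_of_strictMono (PrimeSpectrum.comap (algebraMap R S))
    fun _ _ h => Ideal.IsIntegral.comap_lt_comap h

lemma ringKrullDim_eq_of_isIntegral_of_injective {R S : Type*} [CommRing R] [CommRing S]
    [Algebra R S] [Algebra.IsIntegral R S] (hinj : Function.Injective (algebraMap R S)) :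
    ringKrullDim S = ringKrullDim R := by
  refine le_antisymm (ringKrullDim_le_of_isIntegral R S) (iSup_le fun q => ?_)
  obtain ⟨P, -, hP, hPq⟩ := Ideal.exists_ideal_over_prime_of_isIntegral q.head.asIdeal (⊥ : Ideal S)
    (by rw [← RingHom.ker_eq_comap_bot, (RingHom.injective_iff_ker_eq_bot _).1 hinj]; exact bot_le)
  have : P.LiesOver q.head.asIdeal := ⟨hPq.symm⟩
  obtain ⟨L, hL, -⟩ := Ideal.exists_ltSeries_of_hasGoingUp q P
  rw [← hL]
  exact le_iSup (fun p : LTSeries (PrimeSpectrum S) => ((p.length : ℕ∞) : WithBot ℕ∞)) L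

lemma ringKrullDim_eq_toENat_trdeg (k R : Type*) [Field k] [CommRing R] [IsDomain R]
    [Algebra k R] [Algebra.FiniteType k R] :
    ringKrullDim R = Cardinal.toENat (Algebra.trdeg k R) := by
  obtain ⟨s, g, hg, hint⟩ := exists_integral_inj_algHom_of_fg k R
  algebraize [g.toRingHom]
  have : FaithfulSMul (MvPolynomial (Fin s) k) R := (faithfulSMul_iff_algebraMap_injective _ _).2 hg
  have htr := congrArg Cardinal.toENat (lift_trdeg_add_eq k (MvPolynomial (Fin s) k) (A := R))
  rw [trdeg_of_isDomain, trdeg_eq_zero] at htr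
  simp only [Cardinal.lift_zero, add_zero, Cardinal.toENat_lift, Cardinal.mk_fin,
    map_natCast, Cardinal.lift_natCast] at htr
  rw [ringKrullDim_eq_of_isIntegral_of_injective (R := MvPolynomial (Fin s) k) hg,
    ringKrullDim_of_isNoetherianRing, ringKrullDim_eq_zero_of_field, Nat.card_fin, zero_add, ← htr]
  rfl

lemma trdeg_subalgebra_eq_cardinalMk {k τ : Type*} [Field k] (B : Subalgebra k (MvPolynomial τ k))
    (hB : ∀ t, ∃ b ∈ B, b ≠ 0 ∧ b * X t ∈ B) :
    Algebra.trdeg k B = Cardinal.lift (Cardinal.mk τ) := by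
  have hX : ∀ t, X t ∈ Subalgebra.algebraicClosure B (MvPolynomial τ k) := fun t => by
    obtain ⟨b, hb, hb0, hbX⟩ := hB t
    exact IsAlgebraic.of_mul (mem_nonZeroDivisors_of_ne_zero hb0)
      (isAlgebraic_algebraMap (⟨b, hb⟩ : B)) (isAlgebraic_algebraMap (⟨_, hbX⟩ : B))
  have htop : (Subalgebra.algebraicClosure B (MvPolynomial τ k)).restrictScalars k = ⊤ := by
    rw [eq_top_iff, ← adjoin_range_X, Algebra.adjoin_le_iff]
    exact Set.range_subset_iff.2 hX
  have : Algebra.IsAlgebraic B (MvPolynomial τ k) :=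
    ⟨fun p => (htop.ge trivial : p ∈ Subalgebra.restrictScalars k _)⟩
  rw [← trdeg_of_isDomain (S := k), ← trdeg_add_eq k B (A := MvPolynomial τ k),
    trdeg_eq_zero (R := B), add_zero]

lemma le_of_add_one_le_natCast {d : WithBot ℕ∞} {k : ℕ}
    (h : d + 1 ≤ ((k + 1 : ℕ) : WithBot ℕ∞)) : d ≤ k := by
  induction d with
  | bot => exact bot_le
  | coe d =>
    have hd : d + 1 ≤ (k : ℕ∞) + 1 := by exact_mod_cast h
    exact_mod_cast (ENat.add_le_add_iff_right ENat.one_ne_top).1 hd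

end KrullDimension

section RegularFunctions

variable {σ : Type}

/-- Evaluation of polynomials at a point, typed on `ZariskiSpace σ` instead of `σ → ℂ`. -/
def evalAt (x : ZariskiSpace σ) : MvPolynomial σ ℂ →+* ℂ := eval (x : σ → ℂ)

/-- The regular functions on affine space, as functions given by some polynomial. -/
def IsPoly (f : ZariskiSpace σ → ℂ) : Prop :=
  ∃ p : MvPolynomial σ ℂ, ∀ x, evalAt x p = f x

namespace IsPoly

variable {f g : ZariskiSpace σ → ℂ}

lemma const (c : ℂ) : IsPoly fun _ : ZariskiSpace σ => c := ⟨C c, fun _ => eval_C c⟩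

lemma coord (s : σ) : IsPoly fun x : ZariskiSpace σ => x s := ⟨X s, fun _ => eval_X s⟩

lemma mul (hf : IsPoly f) (hg : IsPoly g) : IsPoly fun x => f x * g x := by
  obtain ⟨p, hp⟩ := hf
  obtain ⟨q, hq⟩ := hg
  exact ⟨p * q, fun x => by rw [map_mul, hp, hq]⟩

lemma sum {ι : Type*} (s : Finset ι) {F : ι → ZariskiSpace σ → ℂ} (h : ∀ i, IsPoly (F i)) :
    IsPoly fun x => ∑ i ∈ s, F i x := by
  choose p hp using h
  exact ⟨∑ i ∈ s, p i, fun x => by simp only [map_sum, hp]⟩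

lemma prod {ι : Type*} (s : Finset ι) {F : ι → ZariskiSpace σ → ℂ} (h : ∀ i, IsPoly (F i)) :
    IsPoly fun x => ∏ i ∈ s, F i x := by
  choose p hp using h
  exact ⟨∏ i ∈ s, p i, fun x => by simp only [map_prod, hp]⟩

variable {m n o : Type*} [Fintype n]

lemma matrix_mul {A : ZariskiSpace σ → Matrix m n ℂ} {B : ZariskiSpace σ → Matrix n o ℂ}
    (hA : ∀ i j, IsPoly fun x => A x i j) (hB : ∀ i j, IsPoly fun x => B x i j) (i : m) (j : o) :
    IsPoly fun x => (A x * B x) i j :=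
  sum _ fun k => (hA i k).mul (hB k j)

lemma vecMul {v : ZariskiSpace σ → n → ℂ} {A : ZariskiSpace σ → Matrix n o ℂ}
    (hv : ∀ i, IsPoly fun x => v x i) (hA : ∀ i j, IsPoly fun x => A x i j) (j : o) :
    IsPoly fun x => Matrix.vecMul (v x) (A x) j :=
  sum _ fun k => (hv k).mul (hA k j)

variable [DecidableEq n] {A : ZariskiSpace σ → Matrix n n ℂ}

lemma det (hA : ∀ i j, IsPoly fun x => A x i j) : IsPoly fun x => (A x).det := by
  simp only [Matrix.det_apply']
  exact sum _ fun k => (const _).mul (prod _ fun i => hA _ _)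

lemma adjugate (hA : ∀ i j, IsPoly fun x => A x i j) (i j : n) :
    IsPoly fun x => (A x).adjugate i j := by
  simp only [Matrix.adjugate_apply]
  refine det fun a b => ?_
  rcases eq_or_ne a j with rfl | ha
  · simpa only [Matrix.updateRow_self] using const _
  · simpa only [Matrix.updateRow_ne ha] using hA a b

end IsPoly

/-- The morphisms between affine spaces: the maps all of whose coordinates are regular. -/
def IsPolyMap {τ : Type} (φ : ZariskiSpace τ → ZariskiSpace σ) : Prop :=
  ∀ s, IsPoly fun x => φ x s

end RegularFunctions

section ZariskiTopology

variable {σ τ : Type}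

lemma isClosed_iff_exists_evalAt_eq_zero {Z : Set (ZariskiSpace σ)} :
    IsClosed Z ↔ ∃ s : Set (MvPolynomial σ ℂ), Z = {x | ∀ p ∈ s, evalAt x p = 0} := by
  have hmem : IsClosed Z ↔ ∃ I : Ideal (MvPolynomial σ ℂ), Z = zeroLocus ℂ I := by
    rw [← isOpen_compl_iff]
    change Zᶜᶜ ∈ {Z : Set (σ → ℂ) | ∃ I : Ideal (MvPolynomial σ ℂ), Z = zeroLocus ℂ I} ↔ _
    rw [compl_compl]
    rfl
  rw [hmem]
  constructor
  · rintro ⟨I, rfl⟩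
    exact ⟨I, rfl⟩
  · rintro ⟨s, rfl⟩
    exact ⟨Ideal.span s, by rw [zeroLocus_span]; rfl⟩

lemma isClosed_setOf_evalAt_eq_zero (p : MvPolynomial σ ℂ) :
    IsClosed {x : ZariskiSpace σ | evalAt x p = 0} :=
  isClosed_iff_exists_evalAt_eq_zero.2 ⟨{p}, Set.ext fun _ => by simp⟩

lemma isPoly_evalAt (p : MvPolynomial σ ℂ) : IsPoly fun x : ZariskiSpace σ => evalAt x p :=
  ⟨p, fun _ => rfl⟩

lemma IsPoly.isClosed {f : ZariskiSpace σ → ℂ} (hf : IsPoly f) : IsClosed {x | f x = 0} := by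
  obtain ⟨p, hp⟩ := hf
  simpa only [hp] using isClosed_setOf_evalAt_eq_zero p

lemma continuous_of_isClosed_evalAt_eq_zero {Y : Type*} [TopologicalSpace Y]
    {γ : Y → ZariskiSpace σ} (hγ : ∀ p : MvPolynomial σ ℂ, IsClosed {y | evalAt (γ y) p = 0}) :
    Continuous γ := by
  refine continuous_iff_isClosed.2 fun Z hZ => ?_
  obtain ⟨s, rfl⟩ := isClosed_iff_exists_evalAt_eq_zero.1 hZ
  simp only [Set.ofPred_forall, Set.preimage_iInter]
  exact isClosed_biInter fun p _ => hγ p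

lemma IsPoly.comp {f : ZariskiSpace σ → ℂ} {φ : ZariskiSpace τ → ZariskiSpace σ} (hf : IsPoly f)
    (hφ : IsPolyMap φ) : IsPoly fun x => f (φ x) := by
  obtain ⟨p, hp⟩ := hf
  choose F hF using hφ
  refine ⟨bind₁ F p, fun x => ((aeval_bind₁ x F p).trans ?_).trans (hp (φ x))⟩
  exact congrArg (fun y : σ → ℂ => eval y p) (funext fun s => hF s x)

lemma IsPolyMap.continuous {φ : ZariskiSpace τ → ZariskiSpace σ} (hφ : IsPolyMap φ) :
    Continuous φ :=
  continuous_of_isClosed_evalAt_eq_zero fun p => ((isPoly_evalAt p).comp hφ).isClosed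

lemma continuous_of_forall_continuous_apply {Y : Type*} [TopologicalSpace Y]
    {γ : Y → ZariskiSpace σ} (hγ : ∀ s, Continuous fun y => γ y s) : Continuous γ :=
  continuous_of_isClosed_evalAt_eq_zero fun p =>
    isClosed_eq ((continuous_eval p).comp (continuous_pi hγ)) continuous_const

instance : IrreducibleSpace (ZariskiSpace σ) where
  toNonempty := ⟨(0 : σ → ℂ)⟩
  isPreirreducible_univ := by
    rintro U V hU hV ⟨x, -, hx⟩ ⟨y, -, hy⟩
    obtain ⟨s, hs⟩ := isClosed_iff_exists_evalAt_eq_zero.1 hU.isClosed_compl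
    obtain ⟨t, ht⟩ := isClosed_iff_exists_evalAt_eq_zero.1 hV.isClosed_compl
    obtain ⟨p, hp, hpx⟩ : ∃ p ∈ s, evalAt x p ≠ 0 := by
      by_contra! h
      exact (hs.ge h : x ∈ Uᶜ) hx
    obtain ⟨q, hq, hqy⟩ : ∃ q ∈ t, evalAt y q ≠ 0 := by
      by_contra! h
      exact (ht.ge h : y ∈ Vᶜ) hy
    have hpq : p * q ≠ 0 := by
      refine mul_ne_zero ?_ ?_ <;> rintro rfl <;> simp at hpx hqy
    obtain ⟨z, hz⟩ : ∃ z : ZariskiSpace σ, evalAt z (p * q) ≠ 0 := by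
      by_contra! h
      exact hpq (MvPolynomial.funext fun z => (h z).trans (map_zero _).symm)
    rw [map_mul, mul_ne_zero_iff] at hz
    exact ⟨z, trivial, by_contra fun h => hz.1 (hs.le h p hp),
      by_contra fun h => hz.2 (ht.le h q hq)⟩

lemma IsPoly.dense_setOf_ne_zero {f : ZariskiSpace σ → ℂ} (hf : IsPoly f) {x : ZariskiSpace σ}
    (hx : f x ≠ 0) : Dense {x | f x ≠ 0} :=
  hf.isClosed.isOpen_compl.dense ⟨x, hx⟩

lemma IsPolyMap.isIrreducible_range {φ : ZariskiSpace τ → ZariskiSpace σ} (hφ : IsPolyMap φ) :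
    IsIrreducible (Set.range φ) := by
  rw [← Set.image_univ]
  exact (IrreducibleSpace.isIrreducible_univ _).image φ hφ.continuous.continuousOn

end ZariskiTopology

section Dimension

variable {σ τ : Type}

/-- The ideal of all polynomials vanishing on `Z`; `zariskiDim Z` is the dimension of its
quotient. -/
abbrev idealOf (Z : Set (ZariskiSpace σ)) : Ideal (MvPolynomial σ ℂ) :=
  MvPolynomial.vanishingIdeal ℂ (K := ℂ) (σ := σ) Z

lemma mem_idealOf {Z : Set (ZariskiSpace σ)} {p : MvPolynomial σ ℂ} :
    p ∈ idealOf Z ↔ ∀ x ∈ Z, evalAt x p = 0 := Iff.rfl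

lemma idealOf_closure (Z : Set (ZariskiSpace σ)) : idealOf (closure Z) = idealOf Z := by
  refine le_antisymm (fun p hp x hx => hp x (subset_closure (X := ZariskiSpace σ) hx))
    fun p hp => ?_
  exact closure_minimal (X := ZariskiSpace σ) (mem_idealOf.1 hp) (isClosed_setOf_evalAt_eq_zero p)

lemma idealOf_isPrime {Z : Set (ZariskiSpace σ)} (hZ : IsIrreducible Z) :
    (idealOf Z).IsPrime := by
  refine ⟨fun h => ?_, fun {p q} hpq => ?_⟩
  · obtain ⟨x, hx⟩ := hZ.nonempty
    exact one_ne_zero ((map_one (evalAt x)).symm.trans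
      (mem_idealOf.1 ((Ideal.eq_top_iff_one _).1 h) x hx))
  · refine isPreirreducible_iff_isClosed_union_isClosed.1 hZ.isPreirreducible
      {x | evalAt x p = 0} {x | evalAt x q = 0}
      (isClosed_setOf_evalAt_eq_zero p) (isClosed_setOf_evalAt_eq_zero q) fun x hx => ?_
    exact mul_eq_zero.1 ((map_mul _ p q).symm.trans (mem_idealOf.1 hpq x hx))

lemma zariskiDim_closure (Z : Set (ZariskiSpace σ)) : zariskiDim (closure Z) = zariskiDim Z := by
  change ringKrullDim (_ ⧸ idealOf (closure Z)) = ringKrullDim (_ ⧸ idealOf Z)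
  rw [idealOf_closure]

lemma zariskiDim_mono {Z W : Set (ZariskiSpace σ)} (h : W ⊆ Z) : zariskiDim W ≤ zariskiDim Z :=
  ringKrullDim_le_of_surjective
    (Ideal.Quotient.factor (vanishingIdeal_anti_mono h : idealOf Z ≤ idealOf W))
    (Ideal.Quotient.factor_surjective _)

lemma zariskiDim_add_one_le {Z W : Set (ZariskiSpace σ)} (hZ : IsIrreducible Z)
    (hW : IsClosed W) (hWZ : W ⊂ Z) : zariskiDim W + 1 ≤ zariskiDim Z := by
  obtain ⟨z, hz, hzW⟩ := Set.exists_of_ssubset hWZ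
  obtain ⟨s, rfl⟩ := isClosed_iff_exists_evalAt_eq_zero.1 hW
  obtain ⟨p, hp, hpz⟩ : ∃ p ∈ s, evalAt z p ≠ 0 := by
    by_contra! h
    exact hzW h
  have := idealOf_isPrime hZ
  have hle : idealOf Z ≤ idealOf _ := vanishingIdeal_anti_mono hWZ.subset
  refine ringKrullDim_succ_le_of_surjective (Ideal.Quotient.factor hle)
    (Ideal.Quotient.factor_surjective hle) (r := Ideal.Quotient.mk _ p)
    (mem_nonZeroDivisors_of_ne_zero fun h => ?_) ?_
  · exact hpz (mem_idealOf.1 (Ideal.Quotient.eq_zero_iff_mem.1 h) z hz)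
  · rw [Ideal.Quotient.factor_mk]
    exact Ideal.Quotient.eq_zero_iff_mem.2 fun x hx => hx p hp

/-- Pulling back along `φ` identifies the coordinate ring of its image with a subalgebra of
`ℂ[τ]`. -/
lemma IsPolyMap.exists_coordinateRing_equiv {φ : ZariskiSpace τ → ZariskiSpace σ}
    (hφ : IsPolyMap φ) :
    ∃ B : Subalgebra ℂ (MvPolynomial τ ℂ),
      Nonempty ((MvPolynomial σ ℂ ⧸ idealOf (Set.range φ)) ≃ₐ[ℂ] B) ∧
      ∀ p, (∃ f, IsPoly f ∧ ∀ x, f (φ x) = evalAt x p) → p ∈ B := by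
  choose F hF using hφ
  have heval (p : MvPolynomial σ ℂ) (x : ZariskiSpace τ) :
      evalAt x (aeval F p) = evalAt (φ x) p :=
    (aeval_bind₁ x F p).trans (congrArg (fun y : σ → ℂ => eval y p) (funext fun s => hF s x))
  have hker : idealOf (Set.range φ) = RingHom.ker (aeval F : MvPolynomial σ ℂ →ₐ[ℂ] _) := by
    ext p
    rw [mem_idealOf, RingHom.mem_ker, Set.forall_mem_range]
    simp only [← heval]
    exact ⟨fun h => MvPolynomial.funext fun x => (h x).trans (map_zero _).symm,
      fun h x => by rw [h, map_zero]⟩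
  refine ⟨(aeval F : MvPolynomial σ ℂ →ₐ[ℂ] _).range,
    ⟨(Ideal.quotientEquivAlgOfEq ℂ hker).trans (Ideal.quotientKerEquivRange _)⟩, ?_⟩
  rintro p ⟨f, ⟨q, hq⟩, hf⟩
  exact ⟨q, MvPolynomial.funext fun x => (heval q x).trans ((hq _).trans (hf x))⟩

/-- The hypothesis `hrat` says that `φ` is birational onto its image. -/
lemma IsPolyMap.zariskiDim_range [Finite σ] [Fintype τ] {φ : ZariskiSpace τ → ZariskiSpace σ}
    (hφ : IsPolyMap φ) (x₀ : ZariskiSpace τ)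
    (hrat : ∀ t, ∃ a b, IsPoly a ∧ IsPoly b ∧ b (φ x₀) ≠ 0 ∧ ∀ x, b (φ x) * x t = a (φ x)) :
    zariskiDim (Set.range φ) = Fintype.card τ := by
  have := idealOf_isPrime hφ.isIrreducible_range
  obtain ⟨B, ⟨e⟩, hB⟩ := hφ.exists_coordinateRing_equiv
  have hX (t : τ) : ∃ b ∈ B, b ≠ 0 ∧ b * X t ∈ B := by
    obtain ⟨a, b, ha, hb, hb₀, hab⟩ := hrat t
    obtain ⟨q, hq⟩ := hb.comp hφ
    refine ⟨q, hB q ⟨b, hb, fun x => (hq x).symm⟩, ?_, hB _ ⟨a, ha, fun x => ?_⟩⟩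
    · rintro rfl
      exact hb₀ ((hq x₀).symm.trans (map_zero _))
    · rw [map_mul, hq, ← hab]
      exact congrArg _ (eval_X t).symm
  calc zariskiDim (Set.range φ)
      = Cardinal.toENat (Algebra.trdeg ℂ (MvPolynomial σ ℂ ⧸ idealOf (Set.range φ))) :=
        ringKrullDim_eq_toENat_trdeg ℂ _
    _ = Fintype.card τ := by
      rw [e.trdeg_eq, trdeg_subalgebra_eq_cardinalMk B hX]
      simp

end Dimension

section IrreducibleComponents

variable {X : Type*} [TopologicalSpace X]

lemma irreducibleComponents_eq_pair {E F : Set X} (hE : IsIrreducible E) (hF : IsIrreducible F)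
    (hEc : IsClosed E) (hFc : IsClosed F) (hcover : E ∪ F = Set.univ) (hEF : ¬ E ⊆ F)
    (hFE : ¬ F ⊆ E) : irreducibleComponents X = {E, F} := by
  have subset_or (T : Set X) (hT : IsIrreducible T) : T ⊆ E ∨ T ⊆ F :=
    isPreirreducible_iff_isClosed_union_isClosed.1 hT.2 E F hEc hFc
      (T.subset_univ.trans hcover.ge)
  ext T
  constructor
  · intro hT
    exact (subset_or T hT.1).imp (fun h => h.antisymm (hT.2 hE h)) fun h => h.antisymm (hT.2 hF h)
  · rintro (rfl | rfl)
    · exact ⟨hE, fun T hT h => (subset_or T hT).resolve_right fun h' => hEF (h.trans h')⟩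
    · exact ⟨hF, fun T hT h => (subset_or T hT).resolve_left fun h' => hFE (h.trans h')⟩

lemma isIrreducible_preimage_val {S T : Set X} (hTS : T ⊆ S) (hT : IsIrreducible T) :
    IsIrreducible ((↑) ⁻¹' T : Set S) := by
  have := Subtype.irreducibleSpace hT
  convert (IrreducibleSpace.isIrreducible_univ T).image (Set.inclusion hTS)
    (continuous_inclusion hTS).continuousOn
  rw [Set.image_univ, Set.range_inclusion]
  rfl

lemma irreducibleComponents_union_eq_pair {E F : Set X} (hE : IsIrreducible E)
    (hF : IsIrreducible F) (hEc : IsClosed E) (hFc : IsClosed F) (hEF : ¬ E ⊆ F) (hFE : ¬ F ⊆ E) :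
    irreducibleComponents ↥(E ∪ F) = {(↑) ⁻¹' E, (↑) ⁻¹' F} := by
  refine irreducibleComponents_eq_pair (isIrreducible_preimage_val Set.subset_union_left hE)
    (isIrreducible_preimage_val Set.subset_union_right hF) (hEc.preimage continuous_subtype_val)
    (hFc.preimage continuous_subtype_val) (Set.eq_univ_of_forall Subtype.prop)
    (fun h => hEF fun x hx => ?_) (fun h => hFE fun x hx => ?_)
  · exact h (a := ⟨x, Or.inl hx⟩) hx
  · exact h (a := ⟨x, Or.inr hx⟩) hx

end IrreducibleComponents

section LinearAlgebra

variable {K l n : Type*} [Field K]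

lemma not_linearIndependent_row_iff [Fintype l] {A : Matrix l n K} :
    ¬ LinearIndependent K A.row ↔ ∃ v : l → K, v ≠ 0 ∧ Matrix.vecMul v A = 0 := by
  rw [Fintype.not_linearIndependent_iff]
  simp only [Matrix.vecMul_eq_sum, Function.ne_iff, and_comm]
  rfl

lemma span_col_eq_top [Finite l] {A : Matrix l n K} (hA : LinearIndependent K A.row) :
    Submodule.span K (Set.range A.col) = ⊤ := by
  cases nonempty_fintype l
  by_contra h
  obtain ⟨φ, hφ, hle⟩ := Submodule.exists_le_ker_of_lt_top _ (lt_top_iff_ne_top.2 h)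
  classical
  have hφ_sum (w : l → K) : φ w = ∑ i, w i * φ (Pi.single i 1) := by
    simp only [φ.pi_apply_eq_sum_univ w, smul_eq_mul, ← Pi.single_apply, Pi.single_comm]
  refine not_linearIndependent_row_iff.2 ⟨fun i => φ (Pi.single i 1), fun h0 => hφ ?_, ?_⟩ hA
  · exact LinearMap.ext fun w => (hφ_sum w).trans (by simp [congrFun h0])
  · ext j
    have : φ (A.col j) = 0 := hle (Submodule.subset_span ⟨j, rfl⟩)
    rw [hφ_sum] at this
    exact (dotProduct_comm _ _).trans this

variable [Fintype l] [DecidableEq l]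

lemma vecMul_transvection (v : l → K) (i j : l) (c : K) :
    Matrix.vecMul v (Matrix.transvection i j c) = v + Pi.single j (v i * c) := by
  rw [Matrix.transvection, Matrix.vecMul_add, Matrix.vecMul_one]
  congr 1
  ext k
  simp [Matrix.vecMul, dotProduct, Matrix.single_apply, Pi.single_apply, ite_and, eq_comm]

lemma exists_det_submatrix_ne_zero {A : Matrix l n K} (hA : LinearIndependent K A.row) :
    ∃ f : l → n, (A.submatrix id f).det ≠ 0 := by
  obtain ⟨κ, a, -, hspan, hli⟩ := exists_linearIndependent' K A.col
  rw [span_col_eq_top hA] at hspan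
  let e : l ≃ κ := (Pi.basisFun K l).indexEquiv (Module.Basis.mk hli hspan.ge)
  have hunit : IsUnit (A.submatrix id (a ∘ e)) :=
    Matrix.linearIndependent_cols_iff_isUnit.1 (hli.comp e e.injective)
  exact ⟨a ∘ e, ((Matrix.isUnit_iff_isUnit_det _).1 hunit).ne_zero⟩

lemma linearIndependent_row_iff_exists_det_submatrix_ne_zero {A : Matrix l n K} :
    LinearIndependent K A.row ↔ ∃ f : l → n, (A.submatrix id f).det ≠ 0 := by
  refine ⟨exists_det_submatrix_ne_zero, fun ⟨f, hf⟩ => ?_⟩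
  have := Matrix.linearIndependent_rows_of_det_ne_zero hf
  exact LinearIndependent.of_comp (LinearMap.funLeft K K f) this

lemma inv_submatrix_mul_apply (C : Matrix l n K) (f : l → n) (k : l) (j : n) :
    ((C.submatrix id f)⁻¹ * C) k j =
      (C.submatrix id f).det⁻¹ * (C.submatrix id (Function.update f k j)).det := by
  have hcol : C.submatrix id (Function.update f k j) =
      (C.submatrix id f).updateCol k (fun i => C i j) := by
    ext a b
    rcases eq_or_ne b k with rfl | hb <;> simp [*]
  rw [hcol, ← Matrix.cramer_apply, Matrix.cramer_eq_adjugate_mulVec, Matrix.inv_def,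
    Ring.inverse_eq_inv', Matrix.smul_mul, Matrix.smul_apply, smul_eq_mul]
  rfl

lemma exists_mul_eq_of_det_submatrix_eq {A B : Matrix l n K} (hA : LinearIndependent K A.row)
    (h : ∀ f : l → n, (A.submatrix id f).det = (B.submatrix id f).det) :
    ∃ g : Matrix.SpecialLinearGroup l K, (g : Matrix l l K) * A = B := by
  obtain ⟨f, hf⟩ := exists_det_submatrix_ne_zero hA
  have hfB := h f ▸ hf
  have hAB : (A.submatrix id f)⁻¹ * A = (B.submatrix id f)⁻¹ * B := by
    ext k j
    simp only [inv_submatrix_mul_apply, h]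
  refine ⟨⟨B.submatrix id f * (A.submatrix id f)⁻¹, ?_⟩, ?_⟩
  · rw [Matrix.det_mul, Matrix.det_nonsing_inv, Ring.inverse_eq_inv', h f, mul_inv_cancel₀ hfB]
  · rw [Matrix.mul_assoc, hAB,
      Matrix.mul_nonsing_inv_cancel_left _ _ (isUnit_iff_ne_zero.2 hfB)]

end LinearAlgebra

section SeparatingVariety

/-- Affine space of pairs of `l × n` matrices, in which the separating variety lives. -/
abbrev PairSpace (l n : ℕ) : Type := ZariskiSpace ((Fin l × Fin n) ⊕ (Fin l × Fin n))

variable {l n : ℕ}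

/-- The first matrix of a pair. -/
def fstMat (p : PairSpace l n) : Matrix (Fin l) (Fin n) ℂ := Matrix.of fun i j => p (Sum.inl (i, j))

/-- The second matrix of a pair. -/
def sndMat (p : PairSpace l n) : Matrix (Fin l) (Fin n) ℂ := Matrix.of fun i j => p (Sum.inr (i, j))

/-- The pair of the matrices `A` and `B` as a point of `PairSpace l n`. -/
def pair (A B : Matrix (Fin l) (Fin n) ℂ) : PairSpace l n :=
  Sum.elim (Function.uncurry A) (Function.uncurry B)

@[simp] lemma fstMat_pair (A B : Matrix (Fin l) (Fin n) ℂ) : fstMat (pair A B) = A := rfl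

@[simp] lemma sndMat_pair (A B : Matrix (Fin l) (Fin n) ℂ) : sndMat (pair A B) = B := rfl

lemma pair_fstMat_sndMat (p : PairSpace l n) : pair (fstMat p) (sndMat p) = p := by
  funext c
  rcases c with c | c <;> rfl

variable (l n) in
/-- The pairs of matrices in the same `SL_l`-orbit. -/
def orbitPairs : Set (PairSpace l n) :=
  {p | ∃ g : Matrix.SpecialLinearGroup (Fin l) ℂ,
    (g : Matrix (Fin l) (Fin l) ℂ) * fstMat p = sndMat p}

variable (l n) in
/-- The pairs of matrices with linearly dependent rows; for `l > 0` this is the square of the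
nullcone. -/
def degeneratePairs : Set (PairSpace l n) :=
  {p | ¬ LinearIndependent ℂ (fstMat p).row ∧ ¬ LinearIndependent ℂ (sndMat p).row}

lemma isPoly_fstMat (i : Fin l) (j : Fin n) : IsPoly fun p : PairSpace l n => fstMat p i j :=
  IsPoly.coord _

lemma isPoly_sndMat (i : Fin l) (j : Fin n) : IsPoly fun p : PairSpace l n => sndMat p i j :=
  IsPoly.coord _

lemma isClosed_degeneratePairs : IsClosed (degeneratePairs l n) := by
  have hminor (f : Fin l → Fin n) : IsClosed {p : PairSpace l n |
      ((fstMat p).submatrix id f).det = 0 ∧ ((sndMat p).submatrix id f).det = 0} :=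
    (IsPoly.det fun i j => isPoly_fstMat i (f j)).isClosed.inter
      (IsPoly.det fun i j => isPoly_sndMat i (f j)).isClosed
  convert isClosed_iInter hminor using 1
  ext p
  simp [degeneratePairs, linearIndependent_row_iff_exists_det_submatrix_ne_zero, forall_and]

lemma mem_separatingVariety_iff {p : PairSpace l n} :
    p ∈ separatingVariety l n ↔ ∀ f ∈ invariants l n,
      eval (Function.uncurry (fstMat p)) f = eval (Function.uncurry (sndMat p)) f := Iff.rfl

lemma isClosed_separatingVariety : IsClosed (separatingVariety l n) := by
  have hfun (f : MvPolynomial (Fin l × Fin n) ℂ) : IsClosed {p : PairSpace l n |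
      eval (fun c => p (Sum.inl c)) f = eval (fun c => p (Sum.inr c)) f} := by
    convert isClosed_setOf_evalAt_eq_zero (rename Sum.inl f - rename Sum.inr f) using 3 with p
    rw [map_sub, sub_eq_zero]
    exact Eq.congr (eval_rename _ _ _).symm (eval_rename _ _ _).symm
  simp only [separatingVariety, Set.ofPred_forall]
  exact isClosed_biInter fun f _ => hfun f

section Invariants

variable {f : MvPolynomial (Fin l × Fin n) ℂ} {A : Matrix (Fin l) (Fin n) ℂ}

lemma eval_mul_of_mem_invariants (hf : f ∈ invariants l n)
    (g : Matrix.SpecialLinearGroup (Fin l) ℂ) (A : Matrix (Fin l) (Fin n) ℂ) :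
    eval (Function.uncurry ((g : Matrix (Fin l) (Fin l) ℂ) * A)) f =
      eval (Function.uncurry A) f := by
  have := hf g⁻¹ (Function.uncurry A)
  rwa [inv_inv g] at this

lemma exists_mul_eq_smul_of_not_linearIndependent (hA : ¬ LinearIndependent ℂ A.row) {t : ℂ}
    (ht : t ≠ 0) : ∃ g : Matrix.SpecialLinearGroup (Fin l) ℂ,
      (g : Matrix (Fin l) (Fin l) ℂ) * A = t • A := by
  obtain ⟨v, hv, hvA⟩ := not_linearIndependent_row_iff.1 hA
  obtain ⟨i, hi : v i ≠ 0⟩ := Function.ne_iff.1 hv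
  let u : Fin l → ℂ := Pi.single i (((t ^ l)⁻¹ - 1) / v i)
  refine ⟨⟨t • (1 + Matrix.vecMulVec u v), ?_⟩, ?_⟩
  · rw [Matrix.det_smul, Fintype.card_fin, Matrix.vecMulVec_eq Unit,
      Matrix.det_one_add_replicateCol_mul_replicateRow, dotProduct_single, mul_div_cancel₀ _ hi,
      add_sub_cancel, mul_inv_cancel₀ (pow_ne_zero l ht)]
  · have hzero : Matrix.vecMulVec u (0 : Fin n → ℂ) = 0 := Matrix.ext fun _ _ => mul_zero _
    simp only [Matrix.smul_mul, Matrix.add_mul, Matrix.one_mul, Matrix.vecMulVec_mul, hvA,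
      hzero, add_zero]

/-- The orbit of a degenerate matrix contains its nonzero multiples, hence `0` is in its closure. -/
lemma eval_eq_eval_zero_of_not_linearIndependent (hf : f ∈ invariants l n)
    (hA : ¬ LinearIndependent ℂ A.row) : eval (Function.uncurry A) f = eval 0 f := by
  have hcont : Continuous fun t : ℂ => eval (t • Function.uncurry A) f :=
    (MvPolynomial.continuous_eval f).comp (continuous_id.smul continuous_const)
  have hconst : (fun t : ℂ => eval (t • Function.uncurry A) f) =
      fun _ => eval (Function.uncurry A) f :=
    hcont.ext_on (dense_compl_singleton (0 : ℂ)) continuous_const fun t ht => by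
      obtain ⟨g, hg⟩ := exists_mul_eq_smul_of_not_linearIndependent hA ht
      have hgf := eval_mul_of_mem_invariants hf g A
      rwa [hg] at hgf
  simpa only [zero_smul] using (congrFun hconst 0).symm

lemma exists_mem_invariants_eval_eq_det (c : Fin l → Fin n) :
    ∃ f ∈ invariants l n, ∀ A : Matrix (Fin l) (Fin n) ℂ,
      eval (Function.uncurry A) f = (A.submatrix id c).det := by
  obtain ⟨q, hq⟩ : IsPoly fun x : ZariskiSpace (Fin l × Fin n) =>
      ((Matrix.of fun i j => x (i, j)).submatrix id c).det :=
    IsPoly.det fun _ _ => IsPoly.coord _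
  refine ⟨q, fun g A => ?_, fun A => hq (Function.uncurry A)⟩
  refine (hq (act g⁻¹ A)).trans (Eq.trans ?_ (hq A).symm)
  refine (Matrix.det_mul _ ((Matrix.of fun i j => A (i, j)).submatrix id c)).trans ?_
  rw [(g⁻¹).2, one_mul]

end Invariants

lemma separatingVariety_eq_union :
    separatingVariety l n = orbitPairs l n ∪ degeneratePairs l n := by
  refine Set.Subset.antisymm (fun p hp => ?_) (Set.union_subset ?_ ?_)
  · have hminor (c : Fin l → Fin n) :
        ((fstMat p).submatrix id c).det = ((sndMat p).submatrix id c).det := by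
      obtain ⟨f, hf, hdet⟩ := exists_mem_invariants_eval_eq_det c
      rw [← hdet, ← hdet, mem_separatingVariety_iff.1 hp f hf]
    by_cases hA : LinearIndependent ℂ (fstMat p).row
    · exact Or.inl (exists_mul_eq_of_det_submatrix_eq hA hminor)
    · refine Or.inr ⟨hA, fun hB => hA ?_⟩
      simpa only [linearIndependent_row_iff_exists_det_submatrix_ne_zero, hminor] using hB
  · rintro p ⟨g, hg⟩
    refine mem_separatingVariety_iff.2 fun f hf => ?_
    rw [← hg, eval_mul_of_mem_invariants hf]
  · rintro p ⟨hA, hB⟩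
    refine mem_separatingVariety_iff.2 fun f hf => ?_
    rw [eval_eq_eval_zero_of_not_linearIndependent hf hA,
      eval_eq_eval_zero_of_not_linearIndependent hf hB]

lemma separatingVariety_eq_closure_union :
    separatingVariety l n = closure (orbitPairs l n) ∪ degeneratePairs l n := by
  refine subset_antisymm ?_
    (Set.union_subset (closure_minimal ?_ isClosed_separatingVariety) ?_)
  · exact separatingVariety_eq_union.subset.trans (Set.union_subset_union_left _ subset_closure)
  · exact separatingVariety_eq_union.ge.trans' Set.subset_union_left
  · exact separatingVariety_eq_union.ge.trans' Set.subset_union_right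

end SeparatingVariety

section Limits

variable {l n : ℕ}

lemma pair_mul_mem_orbitPairs {P Q : Matrix (Fin l) (Fin l) ℂ} (hPQ : P.det = Q.det)
    (hP : P.det ≠ 0) (R : Matrix (Fin l) (Fin n) ℂ) : pair (P * R) (Q * R) ∈ orbitPairs l n := by
  refine ⟨⟨Q * P⁻¹, ?_⟩, ?_⟩
  · rw [Matrix.det_mul, Matrix.det_nonsing_inv, Ring.inverse_eq_inv', ← hPQ, mul_inv_cancel₀ hP]
  · rw [fstMat_pair, sndMat_pair, Matrix.mul_assoc,
      Matrix.nonsing_inv_mul_cancel_left _ _ (isUnit_iff_ne_zero.2 hP)]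

lemma continuous_transvection (i j : Fin l) :
    Continuous fun t : ℂ => Matrix.transvection i j t := by
  suffices Continuous fun t : ℂ => 1 + t • Matrix.single i j (1 : ℂ) by
    simpa only [Matrix.transvection, Matrix.smul_single, smul_eq_mul, mul_one] using this
  fun_prop

/-- Here `ℂ` carries the Euclidean topology and `PairSpace l n` the Zariski topology. -/
lemma pair_mem_closure_of_countable_compl {S : Set (PairSpace l n)}
    {A B : ℂ → Matrix (Fin l) (Fin n) ℂ} (hA : Continuous A) (hB : Continuous B) {s : Set ℂ}
    (hs : s.Countable) (h : ∀ t ∉ s, pair (A t) (B t) ∈ S) (t : ℂ) :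
    pair (A t) (B t) ∈ closure S := by
  have hcont : Continuous fun t => pair (A t) (B t) := by
    refine continuous_of_forall_continuous_apply ?_
    rintro (⟨i, j⟩ | ⟨i, j⟩)
    · exact hA.matrix_elem i j
    · exact hB.matrix_elem i j
  exact map_mem_closure (f := fun t => pair (A t) (B t)) hcont (hs.dense_compl ℂ t) h

end Limits

section OrbitComponent

variable {l n : ℕ} (i₀ : Fin l)

/-- The diagonal matrix with entry `d` at `i₀` and `1` elsewhere. -/
def dilation (d : ℂ) : Matrix (Fin l) (Fin l) ℂ := Matrix.diagonal (Pi.mulSingle i₀ d)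

lemma det_dilation (d : ℂ) : (dilation i₀ d).det = d := by
  rw [dilation, Matrix.det_diagonal, Fintype.prod_pi_mulSingle']

lemma dilation_mul_dilation (d e : ℂ) : dilation i₀ d * dilation i₀ e = dilation i₀ (d * e) := by
  rw [dilation, dilation, dilation, Matrix.diagonal_mul_diagonal', Pi.mulSingle_mul, Pi.mul_def]

lemma dilation_one : dilation i₀ 1 = 1 := by
  rw [dilation, Pi.mulSingle_one, Pi.one_def, Matrix.diagonal_one]

lemma adjugate_dilation (d : ℂ) :
    (dilation i₀ d).adjugate = Matrix.diagonal fun i => if i = i₀ then 1 else d := by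
  rw [dilation, Matrix.adjugate_diagonal]
  congr 1
  ext i
  rcases eq_or_ne i i₀ with rfl | hi <;> simp [*, Ne.symm]

variable (n) in
/-- The coordinates of a pair `(Q, R)`, where `Q` is an `l × l` matrix whose entry at `(i₀, i₀)` is
normalized to `1` and `R` is an `l × n` matrix. -/
abbrev OrbitIndex : Type := {q : Fin l × Fin l // q ≠ (i₀, i₀)} ⊕ (Fin l × Fin n)

variable {i₀}

/-- The matrix `Q` of a parameter `(Q, R)`. -/
def leftFactor (x : ZariskiSpace (OrbitIndex n i₀)) : Matrix (Fin l) (Fin l) ℂ :=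
  Matrix.of fun i j => if h : (i, j) = (i₀, i₀) then 1 else x (Sum.inl ⟨(i, j), h⟩)

/-- The matrix `R` of a parameter `(Q, R)`. -/
def rightFactor (x : ZariskiSpace (OrbitIndex n i₀)) : Matrix (Fin l) (Fin n) ℂ :=
  Matrix.of fun i j => x (Sum.inr (i, j))

/-- The parametrization of a dense subset of the closure of `orbitPairs l n`; if `Q` is invertible,
then `Q * (dilation i₀ Q.det)⁻¹` carries the first matrix to the second one. -/
def orbitParam (x : ZariskiSpace (OrbitIndex n i₀)) : PairSpace l n :=
  pair (dilation i₀ (leftFactor x).det * rightFactor x) (leftFactor x * rightFactor x)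

lemma exists_factors_eq {Q : Matrix (Fin l) (Fin l) ℂ} (hQ : Q i₀ i₀ = 1)
    (R : Matrix (Fin l) (Fin n) ℂ) :
    ∃ x : ZariskiSpace (OrbitIndex n i₀), leftFactor x = Q ∧ rightFactor x = R := by
  refine ⟨Sum.elim (fun q => Q q.1.1 q.1.2) (Function.uncurry R), ?_, rfl⟩
  ext i j
  by_cases h : (i, j) = (i₀, i₀)
  · obtain ⟨rfl, rfl⟩ := Prod.mk.inj h
    simp [leftFactor, hQ]
  · exact dif_neg h

lemma isPoly_leftFactor (i j : Fin l) :
    IsPoly fun x : ZariskiSpace (OrbitIndex n i₀) => leftFactor x i j := by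
  by_cases h : (i, j) = (i₀, i₀)
  · simpa only [leftFactor, Matrix.of_apply, dif_pos h] using IsPoly.const 1
  · simpa only [leftFactor, Matrix.of_apply, dif_neg h] using IsPoly.coord _

lemma isPoly_rightFactor (i : Fin l) (j : Fin n) :
    IsPoly fun x : ZariskiSpace (OrbitIndex n i₀) => rightFactor x i j :=
  IsPoly.coord _

lemma isPolyMap_pair {σ : Type} {A B : ZariskiSpace σ → Matrix (Fin l) (Fin n) ℂ}
    (hA : ∀ i j, IsPoly fun x => A x i j) (hB : ∀ i j, IsPoly fun x => B x i j) :
    IsPolyMap fun x => pair (A x) (B x) := by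
  rintro (⟨i, j⟩ | ⟨i, j⟩)
  · exact hA i j
  · exact hB i j

lemma IsPoly.dilation {σ : Type} {f : ZariskiSpace σ → ℂ} (hf : IsPoly f) (i j : Fin l) :
    IsPoly fun x => dilation i₀ (f x) i j := by
  simp only [SepVar.dilation, Matrix.diagonal_apply, Pi.mulSingle_apply]
  split_ifs
  · exact hf
  · exact const 1
  · exact const 0

lemma isPolyMap_orbitParam :
    IsPolyMap (orbitParam : ZariskiSpace (OrbitIndex n i₀) → PairSpace l n) :=
  isPolyMap_pair
    (IsPoly.matrix_mul (IsPoly.det isPoly_leftFactor).dilation isPoly_rightFactor)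
    (IsPoly.matrix_mul isPoly_leftFactor isPoly_rightFactor)

lemma range_orbitParam_subset :
    Set.range (orbitParam : ZariskiSpace (OrbitIndex n i₀) → _) ⊆ closure (orbitPairs l n) := by
  obtain ⟨x₀, hx₀, -⟩ := exists_factors_eq (i₀ := i₀) (Matrix.one_apply_eq i₀)
    (0 : Matrix (Fin l) (Fin n) ℂ)
  have hdense : Dense {x : ZariskiSpace (OrbitIndex n i₀) | (leftFactor x).det ≠ 0} :=
    (IsPoly.det isPoly_leftFactor).dense_setOf_ne_zero (x := x₀) (by simp [hx₀])
  refine (isPolyMap_orbitParam.continuous.range_subset_closure_image_dense hdense).trans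
    (closure_mono ?_)
  rintro _ ⟨x, hx, rfl⟩
  exact pair_mul_mem_orbitPairs (det_dilation i₀ _) ((det_dilation i₀ _).trans_ne hx) _

lemma pair_mul_mem_range_orbitParam {g : Matrix (Fin l) (Fin l) ℂ} (hg : g.det = 1)
    (hg₀ : g i₀ i₀ ≠ 0) (A : Matrix (Fin l) (Fin n) ℂ) :
    pair A (g * A) ∈ Set.range (orbitParam : ZariskiSpace (OrbitIndex n i₀) → _) := by
  obtain ⟨x, hQ, hR⟩ := exists_factors_eq (i₀ := i₀) (Q := g * dilation i₀ (g i₀ i₀)⁻¹)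
    (by simp [dilation, hg₀]) (dilation i₀ (g i₀ i₀) * A)
  have hdil : dilation i₀ (g i₀ i₀)⁻¹ * dilation i₀ (g i₀ i₀) = 1 := by
    rw [dilation_mul_dilation, inv_mul_cancel₀ hg₀, dilation_one]
  refine ⟨x, ?_⟩
  rw [orbitParam, hQ, hR, Matrix.det_mul, hg, one_mul, det_dilation, ← Matrix.mul_assoc, hdil,
    Matrix.one_mul, Matrix.mul_assoc, ← Matrix.mul_assoc (dilation _ _), hdil, Matrix.one_mul]

lemma orbitPairs_subset_closure_range_orbitParam : orbitPairs l n ⊆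
    closure (Set.range (orbitParam : ZariskiSpace (OrbitIndex n i₀) → _)) := by
  rintro p ⟨g, hg⟩
  rw [← pair_fstMat_sndMat p, ← hg]
  by_cases hg₀ : g i₀ i₀ = 0
  swap
  · exact subset_closure (pair_mul_mem_range_orbitParam g.2 hg₀ _)
  obtain ⟨i, hi⟩ : ∃ i, g i i₀ ≠ 0 := by
    by_contra! h
    exact one_ne_zero (g.2.symm.trans (Matrix.det_eq_zero_of_column_eq_zero i₀ h))
  have hi₀ : i₀ ≠ i := by rintro rfl; exact hi hg₀
  let B (t : ℂ) : Matrix (Fin l) (Fin n) ℂ :=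
    Matrix.transvection i₀ i t * (g : Matrix (Fin l) (Fin l) ℂ) * fstMat p
  have hB : Continuous B :=
    ((continuous_transvection i₀ i).mul continuous_const).matrix_mul continuous_const
  have hBt (t : ℂ) (ht : t ∉ ({0} : Set ℂ)) : pair (fstMat p) (B t) ∈
      Set.range (orbitParam : ZariskiSpace (OrbitIndex n i₀) → _) := by
    refine pair_mul_mem_range_orbitParam ?_ ?_ _
    · rw [Matrix.det_mul, Matrix.det_transvection_of_ne _ _ hi₀, one_mul, g.2]
    · simpa [hg₀, hi] using ht
  simpa only [B, Matrix.transvection_zero, Matrix.one_mul] using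
    pair_mem_closure_of_countable_compl continuous_const hB (Set.countable_singleton 0) hBt 0

lemma closure_orbitPairs_eq (i₀ : Fin l) : closure (orbitPairs l n) =
    closure (Set.range (orbitParam : ZariskiSpace (OrbitIndex n i₀) → _)) :=
  subset_antisymm (closure_minimal orbitPairs_subset_closure_range_orbitParam isClosed_closure)
    (closure_minimal range_orbitParam_subset isClosed_closure)

lemma isIrreducible_closure_orbitPairs (i₀ : Fin l) : IsIrreducible (closure (orbitPairs l n)) := by
  rw [closure_orbitPairs_eq i₀]
  exact isPolyMap_orbitParam.isIrreducible_range.closure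

lemma leftFactor_apply (x : ZariskiSpace (OrbitIndex n i₀)) {i j : Fin l} (h : (i, j) ≠ (i₀, i₀)) :
    leftFactor x i j = x (Sum.inl ⟨(i, j), h⟩) :=
  dif_neg h

lemma leftFactor_apply_self (x : ZariskiSpace (OrbitIndex n i₀)) : leftFactor x i₀ i₀ = 1 :=
  dif_pos rfl

lemma mul_adjugate_dilation_mul (Q R : Matrix (Fin l) (Fin l) ℂ) (d : ℂ) :
    Q * R * (dilation i₀ d * R).adjugate =
      R.det • (Q * Matrix.diagonal fun i => if i = i₀ then 1 else d) := by
  rw [Matrix.adjugate_mul_distrib, adjugate_dilation, Matrix.mul_assoc, ← Matrix.mul_assoc R,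
    Matrix.mul_adjugate, Matrix.smul_mul, Matrix.one_mul, Matrix.mul_smul]

/-- The first `l` columns of an `l × n` matrix. -/
def leadingBlock (hln : l ≤ n) (A : Matrix (Fin l) (Fin n) ℂ) : Matrix (Fin l) (Fin l) ℂ :=
  A.submatrix id (Fin.castLE hln)

lemma leadingBlock_mul (hln : l ≤ n) (P : Matrix (Fin l) (Fin l) ℂ) (R : Matrix (Fin l) (Fin n) ℂ) :
    leadingBlock hln (P * R) = P * leadingBlock hln R :=
  rfl

lemma exists_leadingBlock_eq_one (hln : l ≤ n) :
    ∃ A : Matrix (Fin l) (Fin n) ℂ, leadingBlock hln A = 1 :=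
  ⟨(1 : Matrix (Fin n) (Fin n) ℂ).submatrix (Fin.castLE hln) id,
    Matrix.submatrix_one _ (Fin.castLE_injective hln)⟩

lemma zariskiDim_range_orbitParam (hln : l ≤ n) :
    zariskiDim (Set.range (orbitParam : ZariskiSpace (OrbitIndex n i₀) → _)) =
      Fintype.card (OrbitIndex n i₀) := by
  obtain ⟨R₀, hR₀⟩ := exists_leadingBlock_eq_one hln
  obtain ⟨x₀, hQx₀, hRx₀⟩ := exists_factors_eq (Matrix.one_apply_eq i₀) R₀
  let D (p : PairSpace l n) : ℂ := (leadingBlock hln (fstMat p)).det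
  let G (p : PairSpace l n) : Matrix (Fin l) (Fin l) ℂ :=
    leadingBlock hln (sndMat p) * (leadingBlock hln (fstMat p)).adjugate
  have hDpoly : IsPoly D := IsPoly.det fun i j => isPoly_fstMat _ _
  have hGpoly : ∀ i j, IsPoly fun p => G p i j :=
    IsPoly.matrix_mul (fun i j => isPoly_sndMat _ _) (IsPoly.adjugate fun i j => isPoly_fstMat _ _)
  have hD (x : ZariskiSpace (OrbitIndex n i₀)) :
      D (orbitParam x) = (leftFactor x).det * (leadingBlock hln (rightFactor x)).det := by
    simp only [D, orbitParam, fstMat_pair, leadingBlock_mul, Matrix.det_mul, det_dilation]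
  have hG (x : ZariskiSpace (OrbitIndex n i₀)) (i j : Fin l) :
      G (orbitParam x) i j = (leadingBlock hln (rightFactor x)).det *
      (leftFactor x i j * if j = i₀ then 1 else (leftFactor x).det) := by
    simp only [G, orbitParam, fstMat_pair, sndMat_pair, leadingBlock_mul,
      mul_adjugate_dilation_mul, Matrix.smul_apply, Matrix.mul_diagonal, smul_eq_mul]
  have hD₀ : D (orbitParam x₀) ≠ 0 := by simp [hD, hQx₀, hRx₀, hR₀]
  refine isPolyMap_orbitParam.zariskiDim_range x₀ ?_
  rintro (⟨⟨i, j⟩, hij⟩ | ⟨i, j⟩)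
  · rcases eq_or_ne j i₀ with rfl | hj
    · refine ⟨_, _, hGpoly i j, hGpoly j j, by simp [hG, hQx₀, hRx₀, hR₀], fun x => ?_⟩
      simp only [hG, leftFactor_apply_self, leftFactor_apply x hij, if_pos, mul_one]
    · refine ⟨_, _, hGpoly i j, hDpoly, hD₀, fun x => ?_⟩
      rw [hG, hD, leftFactor_apply x hij, if_neg hj]
      ring
  · rcases eq_or_ne i i₀ with rfl | hi
    · refine ⟨_, _, (isPoly_fstMat i j).mul (hGpoly i i), hDpoly, hD₀, fun x => ?_⟩
      rw [hG, hD, leftFactor_apply_self, if_pos rfl, orbitParam, fstMat_pair, dilation,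
        Matrix.diagonal_mul, Pi.mulSingle_eq_same, rightFactor, Matrix.of_apply]
      ring
    · refine ⟨_, _, isPoly_fstMat i j, IsPoly.const 1, one_ne_zero, fun x => ?_⟩
      rw [orbitParam, fstMat_pair, dilation, Matrix.diagonal_mul, Pi.mulSingle_eq_of_ne hi]
      rfl

lemma card_orbitIndex : Fintype.card (OrbitIndex n i₀) = l * n + l ^ 2 - 1 := by
  have hpos : 0 < l := Fin.pos i₀
  have : 0 < l ^ 2 := by positivity
  simp only [OrbitIndex, Fintype.card_sum, Fintype.card_prod, Fintype.card_fin,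
    Fintype.card_subtype_compl, Fintype.card_unique, ← sq]
  omega

lemma zariskiDim_closure_orbitPairs (i₀ : Fin l) (hln : l ≤ n) :
    zariskiDim (closure (orbitPairs l n)) = (l * n + l ^ 2 - 1 : ℕ) := by
  rw [closure_orbitPairs_eq i₀, zariskiDim_closure, zariskiDim_range_orbitParam hln,
    card_orbitIndex]

end OrbitComponent

section DegenerateComponent

variable {m n : ℕ}

/-- The matrix with rows those of `T`, preceded by their linear combination with coefficients
`w`. -/
def prependComb (w : Fin m → ℂ) (T : Matrix (Fin m) (Fin n) ℂ) : Matrix (Fin (m + 1)) (Fin n) ℂ :=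
  Matrix.of (Matrix.vecCons (Matrix.vecMul w T) T.row)

lemma not_linearIndependent_row_prependComb (w : Fin m → ℂ) (T : Matrix (Fin m) (Fin n) ℂ) :
    ¬ LinearIndependent ℂ (prependComb w T).row := by
  refine not_linearIndependent_row_iff.2 ⟨Matrix.vecCons 1 (-w), ?_, ?_⟩
  · exact fun h => one_ne_zero (congrFun h 0)
  · rw [prependComb, Matrix.cons_vecMul_cons, one_smul, Matrix.neg_vecMul]
    exact add_neg_cancel _

lemma exists_eq_prependComb {A : Matrix (Fin (m + 1)) (Fin n) ℂ} {v : Fin (m + 1) → ℂ}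
    (hv : v 0 ≠ 0) (hvA : Matrix.vecMul v A = 0) : ∃ w T, A = prependComb w T := by
  refine ⟨fun i => -(v i.succ / v 0), A.submatrix Fin.succ id, Matrix.ext fun i j => ?_⟩
  refine Fin.cases ?_ (fun i => rfl) i
  have hj : v 0 * A 0 j + ∑ i : Fin m, v i.succ * A i.succ j = 0 :=
    (Fin.sum_univ_succ _).symm.trans (congrFun hvA j)
  refine mul_left_cancel₀ hv ((eq_neg_of_add_eq_zero_left hj).trans ?_)
  change _ = v 0 * ∑ i : Fin m, -(v i.succ / v 0) * A i.succ j
  rw [Finset.mul_sum, ← Finset.sum_neg_distrib]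
  refine Finset.sum_congr rfl fun i _ => ?_
  field_simp

/-- A row relation `v` with `v 0 = 0` and `v i ≠ 0` is deformed to `v + t • e₀`, a relation of the
matrix obtained by subtracting `t / v i` times the first row from the row `i`. -/
lemma exists_curve_prependComb {A : Matrix (Fin (m + 1)) (Fin n) ℂ}
    (hA : ¬ LinearIndependent ℂ A.row) :
    ∃ γ : ℂ → Matrix (Fin (m + 1)) (Fin n) ℂ, Continuous γ ∧ γ 0 = A ∧
      ∀ t ≠ 0, ∃ w T, γ t = prependComb w T := by
  obtain ⟨v, hv, hvA⟩ := not_linearIndependent_row_iff.1 hA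
  by_cases hv₀ : v 0 = 0
  swap
  · exact ⟨fun _ => A, continuous_const, rfl, fun _ _ => exists_eq_prependComb hv₀ hvA⟩
  obtain ⟨i, hi : v i ≠ 0⟩ := Function.ne_iff.1 hv
  have hi₀ : (0 : Fin (m + 1)) ≠ i := by rintro rfl; exact hi hv₀
  refine ⟨fun t => Matrix.transvection i 0 (-(t / v i)) * A, ?_, by simp, fun t ht => ?_⟩
  · exact ((continuous_transvection i 0).comp (by fun_prop)).matrix_mul continuous_const
  · refine exists_eq_prependComb (v := v + Pi.single 0 t) (by simpa [hv₀] using ht) ?_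
    have hrel : Matrix.vecMul (v + Pi.single 0 t) (Matrix.transvection i 0 (-(t / v i))) = v := by
      rw [vecMul_transvection, Pi.add_apply, Pi.single_eq_of_ne hi₀.symm, add_zero, mul_neg,
        mul_div_cancel₀ _ hi, Pi.single_neg, add_neg_cancel_right]
    rw [← Matrix.vecMul_vecMul, hrel, hvA]

variable (m n) in
/-- The coordinates of a pair `(w, T)`. -/
abbrev CombIndex : Type := Fin m ⊕ (Fin m × Fin n)

/-- The matrix with parameters `(w, T)`. -/
def combParam (y : CombIndex m n → ℂ) : Matrix (Fin (m + 1)) (Fin n) ℂ :=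
  prependComb (y ∘ Sum.inl) (Matrix.of fun i j => y (Sum.inr (i, j)))

/-- The parametrization of a dense subset of `degeneratePairs`. -/
def degenerateParam (x : ZariskiSpace (CombIndex m n ⊕ CombIndex m n)) : PairSpace (m + 1) n :=
  pair (combParam fun k => x (Sum.inl k)) (combParam fun k => x (Sum.inr k))

lemma pair_prependComb_mem_range_degenerateParam (w₁ w₂ : Fin m → ℂ)
    (T₁ T₂ : Matrix (Fin m) (Fin n) ℂ) :
    pair (prependComb w₁ T₁) (prependComb w₂ T₂) ∈ Set.range degenerateParam :=
  ⟨Sum.elim (Sum.elim w₁ (Function.uncurry T₁)) (Sum.elim w₂ (Function.uncurry T₂)), rfl⟩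

lemma IsPoly.prependComb {σ : Type} {w : ZariskiSpace σ → Fin m → ℂ}
    {T : ZariskiSpace σ → Matrix (Fin m) (Fin n) ℂ} (hw : ∀ i, IsPoly fun x => w x i)
    (hT : ∀ i j, IsPoly fun x => T x i j) (i : Fin (m + 1)) (j : Fin n) :
    IsPoly fun x => prependComb (w x) (T x) i j :=
  Fin.cases (vecMul hw hT j) (fun i => hT i j) i

lemma isPolyMap_degenerateParam :
    IsPolyMap (degenerateParam : ZariskiSpace (CombIndex m n ⊕ CombIndex m n) → _) :=
  isPolyMap_pair (IsPoly.prependComb (fun _ => IsPoly.coord _) fun _ _ => IsPoly.coord _)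
    (IsPoly.prependComb (fun _ => IsPoly.coord _) fun _ _ => IsPoly.coord _)

lemma degeneratePairs_eq_closure_range :
    degeneratePairs (m + 1) n = closure (Set.range degenerateParam) := by
  refine subset_antisymm ?_ (closure_minimal ?_ isClosed_degeneratePairs)
  · rintro p ⟨hA, hB⟩
    obtain ⟨α, hα, hα₀, hαt⟩ := exists_curve_prependComb hA
    obtain ⟨β, hβ, hβ₀, hβt⟩ := exists_curve_prependComb hB
    rw [← pair_fstMat_sndMat p, ← hα₀, ← hβ₀]
    refine pair_mem_closure_of_countable_compl hα hβ (Set.countable_singleton 0) (fun t ht => ?_) 0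
    obtain ⟨w₁, T₁, h₁⟩ := hαt t ht
    obtain ⟨w₂, T₂, h₂⟩ := hβt t ht
    rw [h₁, h₂]
    exact pair_prependComb_mem_range_degenerateParam w₁ w₂ T₁ T₂
  · rintro _ ⟨x, rfl⟩
    exact ⟨not_linearIndependent_row_prependComb _ _, not_linearIndependent_row_prependComb _ _⟩

lemma isIrreducible_degeneratePairs : IsIrreducible (degeneratePairs (m + 1) n) := by
  rw [degeneratePairs_eq_closure_range]
  exact isPolyMap_degenerateParam.isIrreducible_range.closure

lemma IsPoly.det_leadingBlock {σ : Type} (hmn : m ≤ n)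
    {T : ZariskiSpace σ → Matrix (Fin m) (Fin n) ℂ} (hT : ∀ i j, IsPoly fun x => T x i j) :
    IsPoly fun x => (leadingBlock hmn (T x)).det :=
  det fun i j => hT i (Fin.castLE hmn j)

/-- By Cramer's rule, `w` is a rational function of `T` and `w ᵥ* T`. -/
lemma exists_isPoly_det_leadingBlock_mul_eq {σ : Type} (hmn : m ≤ n)
    {u : ZariskiSpace σ → Fin n → ℂ} {T : ZariskiSpace σ → Matrix (Fin m) (Fin n) ℂ}
    (hu : ∀ j, IsPoly fun x => u x j) (hT : ∀ i j, IsPoly fun x => T x i j) (i : Fin m) :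
    ∃ a, IsPoly a ∧
      ∀ x w, Matrix.vecMul w (T x) = u x → (leadingBlock hmn (T x)).det * w i = a x := by
  refine ⟨_, IsPoly.vecMul (fun j => hu (Fin.castLE hmn j))
    (IsPoly.adjugate fun i j => hT i (Fin.castLE hmn j)) i, fun x w hw => ?_⟩
  have hblock : (fun j => u x (Fin.castLE hmn j)) = Matrix.vecMul w (leadingBlock hmn (T x)) :=
    funext fun j => (congrFun hw (Fin.castLE hmn j)).symm
  have hcramer : Matrix.vecMul (Matrix.vecMul w (leadingBlock hmn (T x)))
      (leadingBlock hmn (T x)).adjugate = (leadingBlock hmn (T x)).det • w := by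
    rw [Matrix.vecMul_vecMul, Matrix.mul_adjugate, Matrix.vecMul_smul, Matrix.vecMul_one]
  rw [hblock]
  exact (congrFun hcramer i).symm

lemma zariskiDim_degeneratePairs (hmn : m ≤ n) :
    zariskiDim (degeneratePairs (m + 1) n) = (2 * (n + 1) * m : ℕ) := by
  obtain ⟨T₀, hT₀⟩ := exists_leadingBlock_eq_one hmn
  have hdet : (leadingBlock hmn T₀).det ≠ 0 := by rw [hT₀, Matrix.det_one]; exact one_ne_zero
  have hcard : 2 * (n + 1) * m = Fintype.card (CombIndex m n ⊕ CombIndex m n) := by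
    simp only [Fintype.card_sum, Fintype.card_prod, Fintype.card_fin]
    ring
  rw [degeneratePairs_eq_closure_range, zariskiDim_closure, hcard]
  let y₀ : CombIndex m n → ℂ := Sum.elim 0 (Function.uncurry T₀)
  have hfst (i j) : IsPoly fun p : PairSpace (m + 1) n => (fstMat p).submatrix Fin.succ id i j :=
    isPoly_fstMat _ _
  have hsnd (i j) : IsPoly fun p : PairSpace (m + 1) n => (sndMat p).submatrix Fin.succ id i j :=
    isPoly_sndMat _ _
  refine isPolyMap_degenerateParam.zariskiDim_range (Sum.elim y₀ y₀) ?_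
  rintro ((i | ⟨i, j⟩) | (i | ⟨i, j⟩))
  · obtain ⟨a, ha, hab⟩ := exists_isPoly_det_leadingBlock_mul_eq hmn (isPoly_fstMat 0) hfst i
    exact ⟨a, _, ha, IsPoly.det_leadingBlock hmn hfst, hdet,
      fun x => hab _ (fun i => x (Sum.inl (Sum.inl i))) rfl⟩
  · exact ⟨_, _, hfst i j, IsPoly.const 1, one_ne_zero, fun x => one_mul _⟩
  · obtain ⟨a, ha, hab⟩ := exists_isPoly_det_leadingBlock_mul_eq hmn (isPoly_sndMat 0) hsnd i
    exact ⟨a, _, ha, IsPoly.det_leadingBlock hmn hsnd, hdet,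
      fun x => hab _ (fun i => x (Sum.inr (Sum.inl i))) rfl⟩
  · exact ⟨_, _, hsnd i j, IsPoly.const 1, one_ne_zero, fun x => one_mul _⟩

end DegenerateComponent

section Intersection

variable {l n : ℕ}

lemma pair_mul_mem_closure_orbitPairs {P Q : ℂ → Matrix (Fin l) (Fin l) ℂ} (hP : Continuous P)
    (hQ : Continuous Q) (hPQ : ∀ t, (P t).det = (Q t).det) {s : Set ℂ} (hs : s.Countable)
    (hPs : ∀ t ∉ s, (P t).det ≠ 0) (R : Matrix (Fin l) (Fin n) ℂ) (t : ℂ) :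
    pair (P t * R) (Q t * R) ∈ closure (orbitPairs l n) :=
  pair_mem_closure_of_countable_compl (hP.matrix_mul continuous_const)
    (hQ.matrix_mul continuous_const) hs
    (fun t ht => pair_mul_mem_orbitPairs (hPQ t) (hPs t ht) R) t

/-- For `l = 2`, the matrices with rows `w • a, a` and `u • b, b` are the limits of the pairs with
rows `t • b + w • a, a` and `u • b - t • a, b`, whose minors agree. -/
lemma degeneratePairs_two_subset : degeneratePairs 2 n ⊆ closure (orbitPairs 2 n) := by
  rw [degeneratePairs_eq_closure_range]
  refine closure_minimal ?_ isClosed_closure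
  rintro _ ⟨x, rfl⟩
  let w := x (Sum.inl (Sum.inl 0))
  let u := x (Sum.inr (Sum.inl 0))
  let R : Matrix (Fin 2) (Fin n) ℂ :=
    Matrix.of fun i j => ![x (Sum.inr (Sum.inr (0, j))), x (Sum.inl (Sum.inr (0, j)))] i
  have hlim := pair_mul_mem_closure_orbitPairs (P := fun t => !![t, w; 0, 1])
    (Q := fun t => !![u, -t; 1, 0])
    (continuous_matrix fun i j => by fin_cases i <;> fin_cases j <;> fun_prop)
    (continuous_matrix fun i j => by fin_cases i <;> fin_cases j <;> fun_prop)
    (fun t => by simp [Matrix.det_fin_two_of]) (Set.countable_singleton 0)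
    (fun t ht => by simpa [Matrix.det_fin_two_of] using ht) R 0
  convert hlim using 1
  refine congrArg₂ pair ?_ ?_ <;>
  · ext i j
    fin_cases i <;>
      simp [combParam, prependComb, Matrix.mul_apply, Fin.sum_univ_two, Matrix.vecMul, dotProduct,
        R, w, u]

lemma separatingVariety_two : separatingVariety 2 n = closure (orbitPairs 2 n) := by
  rw [separatingVariety_eq_closure_union, Set.union_eq_left.2 degeneratePairs_two_subset]

variable (n) in
/-- The coordinates of a tuple `(R, a, b, c)` where `R` is a `3 × n` matrix, `a` and `b` are vectors
of length `2` and `c` is a vector of length `3`. -/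
abbrev MeetIndex : Type := ((Fin 3 × Fin n) ⊕ Fin 2) ⊕ (Fin 2 ⊕ Fin 3)

/-- The matrix `R` of a parameter `(R, a, b, c)`. -/
def meetMat (x : ZariskiSpace (MeetIndex n)) : Matrix (Fin 3) (Fin n) ℂ :=
  Matrix.of fun i j => x (Sum.inl (Sum.inl (i, j)))

/-- A parametrization of pairs of degenerate `3 × n` matrices that are limits of pairs in the same
orbit: for `R` with rows `r₀, r₁, r₂`, the matrices have rows `a₀ r₁ + a₁ r₂, r₁, r₂` and
`b₀ r₀ + b₁ (c ᵥ* R), r₀, c ᵥ* R`. -/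
def meetParam (x : ZariskiSpace (MeetIndex n)) : PairSpace 3 n :=
  pair (prependComb (fun i => x (Sum.inl (Sum.inr i))) ((meetMat x).submatrix Fin.succ id))
    (prependComb (fun i => x (Sum.inr (Sum.inl i)))
      (Matrix.of ![meetMat x 0, Matrix.vecMul (fun i => x (Sum.inr (Sum.inr i))) (meetMat x)]))

lemma isPolyMap_meetParam : IsPolyMap (meetParam : ZariskiSpace (MeetIndex n) → _) := by
  refine isPolyMap_pair (IsPoly.prependComb (fun _ => IsPoly.coord _) fun _ _ => IsPoly.coord _)
    (IsPoly.prependComb (fun _ => IsPoly.coord _) fun i j => ?_)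
  fin_cases i
  · exact IsPoly.coord _
  · exact IsPoly.vecMul (v := fun x i => x (Sum.inr (Sum.inr i))) (A := meetMat)
      (fun _ => IsPoly.coord _) (fun _ _ => IsPoly.coord _) j

lemma meetParam_mem_closure_orbitPairs (x : ZariskiSpace (MeetIndex n)) :
    meetParam x ∈ closure (orbitPairs 3 n) := by
  let a (i : Fin 2) := x (Sum.inl (Sum.inr i))
  let b (i : Fin 2) := x (Sum.inr (Sum.inl i))
  let c (i : Fin 3) := x (Sum.inr (Sum.inr i))
  have hlim := pair_mul_mem_closure_orbitPairs
    (P := fun t => !![t * (c 1 + t), a 0, a 1; 0, 1, 0; 0, 0, 1])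
    (Q := fun t => !![b 0 + b 1 * c 0, b 1 * (c 1 + t), t + b 1 * c 2; 1, 0, 0; c 0, c 1 + t, c 2])
    (continuous_matrix fun i j => by fin_cases i <;> fin_cases j <;> fun_prop)
    (continuous_matrix fun i j => by fin_cases i <;> fin_cases j <;> fun_prop)
    (fun t => by simp [Matrix.det_fin_three]; ring) (Set.toFinite {0, -c 1}).countable
    (fun t ht => by
      simpa [Matrix.det_fin_three, add_comm (c 1), ← eq_neg_iff_add_eq_zero] using ht)
    (meetMat x) 0
  convert hlim using 1
  refine congrArg₂ pair ?_ ?_ <;>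
  · ext i j
    fin_cases i <;>
      simp [prependComb, Matrix.mul_apply, Fin.sum_univ_succ, Matrix.vecMul, dotProduct,
        Matrix.vecHead, Matrix.vecTail, a, b, c] <;>
      ring

lemma range_meetParam_subset : Set.range (meetParam : ZariskiSpace (MeetIndex n) → _) ⊆
    closure (orbitPairs 3 n) ∩ degeneratePairs 3 n := by
  rintro _ ⟨x, rfl⟩
  exact ⟨meetParam_mem_closure_orbitPairs x, not_linearIndependent_row_prependComb _ _,
    not_linearIndependent_row_prependComb _ _⟩

lemma exists_meetParam_minors_ne_zero (h₃ : 3 ≤ n) :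
    ∃ x : ZariskiSpace (MeetIndex n), (leadingBlock h₃ (meetMat x)).det ≠ 0 ∧
      (leadingBlock (Nat.le_of_succ_le h₃)
        ((fstMat (meetParam x)).submatrix Fin.succ id)).det ≠ 0 ∧
      (leadingBlock (Nat.le_of_succ_le h₃)
        ((sndMat (meetParam x)).submatrix Fin.succ id)).det ≠ 0 := by
  have h₂ := Nat.le_of_succ_le h₃
  obtain ⟨J, hJ⟩ := exists_leadingBlock_eq_one h₃
  let M : Matrix (Fin 3) (Fin 3) ℂ := !![1, 0, 1; 1, 0, 0; 0, 1, 0]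
  let x : ZariskiSpace (MeetIndex n) :=
    Sum.elim (Sum.elim (Function.uncurry (M * J)) 0) (Sum.elim 0 ![0, 0, 1])
  have hblock : leadingBlock h₃ (meetMat x) = M := by
    rw [← Matrix.mul_one M, ← hJ]
    rfl
  have hentry (i : Fin 3) (j : Fin 2) :
      meetMat x i (Fin.castLE h₂ j) = M i j.castSucc :=
    congrFun (congrFun hblock i) j.castSucc
  have hfst : leadingBlock h₂ ((fstMat (meetParam x)).submatrix Fin.succ id) = 1 := by
    ext i j
    refine (hentry i.succ j).trans ?_
    fin_cases i <;> fin_cases j <;> rfl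
  have hsnd : leadingBlock h₂ ((sndMat (meetParam x)).submatrix Fin.succ id) = 1 := by
    have hrow (j) : Matrix.vecMul ![0, 0, 1] (meetMat x) j = meetMat x 2 j := by
      simp [Matrix.vecMul, dotProduct, Fin.sum_univ_succ]
    ext i j
    fin_cases i
    · refine (hentry 0 j).trans ?_
      fin_cases j <;> rfl
    · refine ((hrow _).trans (hentry 2 j)).trans ?_
      fin_cases j <;> rfl
  refine ⟨x, ?_, ?_, ?_⟩
  · simp [hblock, M, Matrix.det_fin_three]
  · simp [hfst]
  · simp [hsnd]

lemma zariskiDim_range_meetParam (h₃ : 3 ≤ n) :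
    zariskiDim (Set.range (meetParam : ZariskiSpace (MeetIndex n) → _)) = (3 * n + 7 : ℕ) := by
  have h₂ : 2 ≤ n := by omega
  obtain ⟨x₀, hx₀, hfst₀, hsnd₀⟩ := exists_meetParam_minors_ne_zero h₃
  let R (p : PairSpace 3 n) : Matrix (Fin 3) (Fin n) ℂ :=
    Matrix.of ![sndMat p 1, fstMat p 1, fstMat p 2]
  have hRx (x : ZariskiSpace (MeetIndex n)) : R (meetParam x) = meetMat x := by
    ext i j
    fin_cases i <;> rfl
  have hR (i j) : IsPoly fun p => R p i j := by
    fin_cases i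
    exacts [isPoly_sndMat _ _, isPoly_fstMat _ _, isPoly_fstMat _ _]
  have hfst (i j) : IsPoly fun p : PairSpace 3 n => (fstMat p).submatrix Fin.succ id i j :=
    isPoly_fstMat _ _
  have hsnd (i j) : IsPoly fun p : PairSpace 3 n => (sndMat p).submatrix Fin.succ id i j :=
    isPoly_sndMat _ _
  have hcard : 3 * n + 7 = Fintype.card (MeetIndex n) := by
    simp only [Fintype.card_sum, Fintype.card_prod, Fintype.card_fin]
  rw [hcard]
  refine isPolyMap_meetParam.zariskiDim_range x₀ ?_
  rintro ((⟨i, j⟩ | i) | (i | i))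
  · exact ⟨_, _, hR i j, IsPoly.const 1, one_ne_zero, fun x => by rw [hRx, one_mul]; rfl⟩
  · obtain ⟨a, ha, hab⟩ := exists_isPoly_det_leadingBlock_mul_eq h₂ (isPoly_fstMat 0) hfst i
    exact ⟨a, _, ha, IsPoly.det_leadingBlock h₂ hfst, hfst₀,
      fun x => hab _ (fun i => x (Sum.inl (Sum.inr i))) rfl⟩
  · obtain ⟨a, ha, hab⟩ := exists_isPoly_det_leadingBlock_mul_eq h₂ (isPoly_sndMat 0) hsnd i
    exact ⟨a, _, ha, IsPoly.det_leadingBlock h₂ hsnd, hsnd₀,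
      fun x => hab _ (fun i => x (Sum.inr (Sum.inl i))) rfl⟩
  · obtain ⟨a, ha, hab⟩ := exists_isPoly_det_leadingBlock_mul_eq h₃ (isPoly_sndMat 2) hR i
    exact ⟨a, _, ha, IsPoly.det_leadingBlock h₃ hR, by rwa [hRx],
      fun x => hab _ (fun i => x (Sum.inr (Sum.inr i))) (by rw [hRx]; rfl)⟩

end Intersection

section Components

variable {l n : ℕ}

lemma not_closure_orbitPairs_subset (hln : l ≤ n) :
    ¬ closure (orbitPairs l n) ⊆ degeneratePairs l n := by
  obtain ⟨A, hA⟩ := exists_leadingBlock_eq_one hln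
  have hdet : (A.submatrix id (Fin.castLE hln)).det ≠ 0 :=
    (congrArg Matrix.det hA).trans_ne (by simp)
  intro h
  refine (h (subset_closure (?_ : pair A A ∈ orbitPairs l n))).1
    (linearIndependent_row_iff_exists_det_submatrix_ne_zero.2 ⟨_, hdet⟩)
  exact ⟨1, Matrix.one_mul A⟩

lemma zariskiDim_inter_le (i₀ : Fin l) (hln : l ≤ n) :
    zariskiDim (closure (orbitPairs l n) ∩ degeneratePairs l n) ≤ (l * n + l ^ 2 - 2 : ℕ) := by
  have hssubset : closure (orbitPairs l n) ∩ degeneratePairs l n ⊂ closure (orbitPairs l n) :=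
    Set.inter_ssubset_left_iff.2 (not_closure_orbitPairs_subset hln)
  have hle := zariskiDim_add_one_le (isIrreducible_closure_orbitPairs i₀)
    (isClosed_closure.inter isClosed_degeneratePairs) hssubset
  have hpos : 0 < l := Fin.pos i₀
  have hnum : l * n + l ^ 2 - 1 = l * n + l ^ 2 - 2 + 1 := by
    have : 0 < l * n := Nat.mul_pos hpos (by omega)
    have : 0 < l ^ 2 := by positivity
    omega
  rw [zariskiDim_closure_orbitPairs i₀ hln, hnum] at hle
  exact le_of_add_one_le_natCast hle

lemma zariskiDim_inter_three (hn : 3 ≤ n) :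
    zariskiDim (closure (orbitPairs 3 n) ∩ degeneratePairs 3 n) = (3 * n + 3 ^ 2 - 2 : ℕ) := by
  refine le_antisymm (zariskiDim_inter_le 0 hn) ?_
  exact (zariskiDim_range_meetParam hn).symm.trans_le (zariskiDim_mono range_meetParam_subset)

lemma not_degeneratePairs_subset (hl : 3 ≤ l) (hln : l + 1 ≤ n) :
    ¬ degeneratePairs l n ⊆ closure (orbitPairs l n) := by
  intro h
  obtain ⟨m, rfl⟩ := Nat.exists_eq_add_of_le' (show 1 ≤ l by omega)
  have hle := zariskiDim_add_one_le (isIrreducible_closure_orbitPairs 0) isClosed_degeneratePairs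
    (h.ssubset_of_not_subset (not_closure_orbitPairs_subset (by omega)))
  rw [zariskiDim_degeneratePairs (by omega), zariskiDim_closure_orbitPairs 0 (by omega)] at hle
  have hlt : 2 * (n + 1) * m + 1 ≤ (m + 1) * n + (m + 1) ^ 2 - 1 := by exact_mod_cast hle
  have : (m + 1) * n + (m + 1) ^ 2 ≤ 2 * (n + 1) * m + 1 := by
    nlinarith
  omega

end Components

end SepVar

end

open SepVar in
theorem theorem1p3 :
    (∀ l n : ℕ, 3 ≤ l → l + 1 ≤ n →
      ∃ C₁ C₂ : Set (SepVar.separatingVariety l n),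
        C₁ ≠ C₂ ∧
        irreducibleComponents (SepVar.separatingVariety l n) = {C₁, C₂} ∧
        SepVar.zariskiDim (Subtype.val '' C₁) = ((l * n + l ^ 2 - 1 : ℕ) : WithBot ℕ∞) ∧
        SepVar.zariskiDim (Subtype.val '' C₂) = ((2 * (n + 1) * (l - 1) : ℕ) : WithBot ℕ∞) ∧
        IsClosed (Subtype.val '' (C₁ ∩ C₂)) ∧
        SepVar.zariskiDim (Subtype.val '' (C₁ ∩ C₂)) ≤
          ((l * n + l ^ 2 - 2 : ℕ) : WithBot ℕ∞) ∧
        (l = 3 → SepVar.zariskiDim (Subtype.val '' (C₁ ∩ C₂)) =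
          ((l * n + l ^ 2 - 2 : ℕ) : WithBot ℕ∞))) ∧
    (∀ n : ℕ, IsIrreducible (SepVar.separatingVariety 2 n)) := by
  refine ⟨fun l n hl hn => ?_, fun n => ?_⟩
  · obtain ⟨m, rfl⟩ := Nat.exists_eq_add_of_le' (show 1 ≤ l by omega)
    have hln : m + 1 ≤ n := by omega
    have horbit := not_closure_orbitPairs_subset hln
    have hinter := zariskiDim_inter_le 0 hln
    rw [separatingVariety_eq_closure_union]
    refine ⟨Subtype.val ⁻¹' closure (orbitPairs (m + 1) n),
      Subtype.val ⁻¹' degeneratePairs (m + 1) n, ?_,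
      irreducibleComponents_union_eq_pair (isIrreducible_closure_orbitPairs 0)
        isIrreducible_degeneratePairs isClosed_closure isClosed_degeneratePairs
        horbit (not_degeneratePairs_subset hl hn), ?_⟩
    · exact fun h => horbit fun p hp => (Set.ext_iff.1 h ⟨p, Or.inl hp⟩).1 hp
    · rw [Set.image_inter Subtype.val_injective, Subtype.image_preimage_coe,
        Subtype.image_preimage_coe, Set.inter_eq_right.2 Set.subset_union_left,
        Set.inter_eq_right.2 Set.subset_union_right]
      refine ⟨zariskiDim_closure_orbitPairs 0 hln, zariskiDim_degeneratePairs (by omega),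
        isClosed_closure.inter isClosed_degeneratePairs, hinter, fun h => ?_⟩
      obtain rfl : m = 2 := by omega
      exact zariskiDim_inter_three hln
  · rw [separatingVariety_two]
    exact isIrreducible_closure_orbitPairs 0
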